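/- Let $(X_\alpha)_{\alpha\in I}$ be a family, indexed by an arbitrary set $I$, of nonempty completely regular Hausdorff spaces. For a completely regular Hausdorff space $Y$, let $\beta Y$ denote its Stone–Čech compactification, and let $\coprod$ denote the disjoint union of topological spaces with the disjoint union topology. Then $\beta\bigl(\coprod_{\alpha\in I} X_\alpha\bigr)$ is homeomorphic to $\coprod_{\alpha\in I}\beta X_\alpha$ if and only if $I$ is finite. -/

import Mathlib

/-! A finite disjoint union of compact Hausdorff spaces is compact Hausdorff, so `Σ i, StoneCech (X
i)` has the universal property of `StoneCech (Σ i, X i)`. Conversely, a compact disjoint union of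
nonempty spaces maps continuously onto its discrete index set. -/

/-- A disjoint union of nonempty spaces is compact only if the index set is finite. -/
theorem finite_of_compactSpace_sigma {I : Type*} (Y : I → Type*) [∀ i, TopologicalSpace (Y i)]
    [∀ i, Nonempty (Y i)] [CompactSpace (Σ i, Y i)] : Finite I := by
  let : TopologicalSpace I := ⊥
  have : DiscreteTopology I := ⟨rfl⟩
  have hc : Continuous (Sigma.fst : (Σ i, Y i) → I) :=
    continuous_sigma fun _ => continuous_const
  have hs : Function.Surjective (Sigma.fst : (Σ i, Y i) → I) :=
    fun i => ⟨⟨i, Classical.arbitrary _⟩, rfl⟩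
  have : CompactSpace I := hs.compactSpace hc
  exact finite_of_compact_of_discrete

/-- The Stone–Čech compactification commutes with finite disjoint unions. -/
noncomputable def stoneCechSigmaHomeomorph {I : Type*} [Finite I] (X : I → Type*)
    [∀ i, TopologicalSpace (X i)] : StoneCech (Σ i, X i) ≃ₜ (Σ i, StoneCech (X i)) :=
  have hu : Continuous fun p : Σ i, X i =>
      (⟨p.1, stoneCechUnit p.2⟩ : Σ i, StoneCech (X i)) :=
    continuous_sigma fun i =>
      (continuous_sigmaMk (σ := fun i => StoneCech (X i)) (i := i)).comp continuous_stoneCechUnit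
  have hi : ∀ i, Continuous fun x : X i => (stoneCechUnit (⟨i, x⟩ : Σ i, X i)) :=
    fun _ => continuous_stoneCechUnit.comp continuous_sigmaMk
  have hg : Continuous fun p : Σ i, StoneCech (X i) => stoneCechExtend (hi p.1) p.2 :=
    continuous_sigma fun i => continuous_stoneCechExtend (hi i)
  -- Finiteness of `I` enters here: extending `hu` needs a compact target.
  have hleft : ∀ (i : I) (x : X i), stoneCechExtend (hi (stoneCechExtend hu
      (stoneCechUnit ⟨i, x⟩)).1) (stoneCechExtend hu (stoneCechUnit ⟨i, x⟩)).2 =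
      stoneCechUnit ⟨i, x⟩ := fun i x =>
    (congrArg (fun p : Σ i, StoneCech (X i) => stoneCechExtend (hi p.1) p.2)
      (stoneCechExtend_stoneCechUnit hu ⟨i, x⟩)).trans (stoneCechExtend_stoneCechUnit (hi i) x)
  have hright : ∀ (i : I) (x : X i),
      stoneCechExtend hu (stoneCechExtend (hi i) (stoneCechUnit x)) = ⟨i, stoneCechUnit x⟩ :=
    fun i x => (congrArg _ (stoneCechExtend_stoneCechUnit (hi i) x)).trans
      (stoneCechExtend_stoneCechUnit hu ⟨i, x⟩)
  { toFun := stoneCechExtend hu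
    invFun := fun p => stoneCechExtend (hi p.1) p.2
    -- Both inverse laws need checking only on the dense images of the units, as the targets are
    -- Hausdorff.
    left_inv := congrFun (stoneCech_hom_ext (hg.comp (continuous_stoneCechExtend hu))
      continuous_id (funext fun p => hleft p.1 p.2))
    right_inv := fun ⟨i, y⟩ => congrFun (stoneCech_hom_ext
      (g₁ := fun y => stoneCechExtend hu (stoneCechExtend (hi i) y))
      (g₂ := fun y => (⟨i, y⟩ : Σ i, StoneCech (X i)))
      ((continuous_stoneCechExtend hu).comp (continuous_stoneCechExtend (hi i)))
      (continuous_sigmaMk (σ := fun i => StoneCech (X i))) (funext (hright i))) y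
    continuous_toFun := continuous_stoneCechExtend hu
    continuous_invFun := hg }

theorem mainTheorem7 {I : Type*} (X : I → Type*)
    [∀ i, TopologicalSpace (X i)] [∀ i, T35Space (X i)] [∀ i, Nonempty (X i)] :
    Nonempty (StoneCech (Σ i, X i) ≃ₜ (Σ i, StoneCech (X i))) ↔ Finite I := by
  refine ⟨fun ⟨e⟩ => ?_, fun _ => ⟨stoneCechSigmaHomeomorph X⟩⟩
  have : CompactSpace (Σ i, StoneCech (X i)) := e.compactSpace
  have : ∀ i, Nonempty (StoneCech (X i)) := fun i => ⟨stoneCechUnit (Classical.arbitrary (X i))⟩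
  exact finite_of_compactSpace_sigma fun i => StoneCech (X i)
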